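/- Fix countably infinite sets of standard names of the sorts object (including $\mathbb Q$), action (action symbols applied to object names) and clock. A timed trace $z$ is a finite sequence $(a_1,t_1)\cdots(a_k,t_k)$ of action names with non-decreasing times $t_i\in\mathbb R_{\ge0}$; $\mathrm{time}(z)=t_k$, and $\mathrm{time}(\langle\rangle)=0$. A world $w$ assigns a truth value to every primitive formula (predicate with standard names as arguments, including $\mathit{Poss}(a)$ and $\mathit{reset}(c)$) after every timed trace, constant in the trace for rigid predicates, and to $g(a)$ after every timed trace and clock valuation. A basic action theory $\Sigma$ over a finite set of fluents $\mathcal F$ and a finite set of clocks $C$ consists of fluent sentences $\Sigma_0$ (true initially), and axioms $\Box\,\mathit{Poss}(a)\equiv\bigvee_o\pi_o$, $\Box\,g(a)\equiv g_a$ with a clock formula $g_a$ over $C$ ($g_a=\top$ if no axiom is listed for $a$), $\Box[a]F(\vec x)\equiv\gamma_F$ for $F\in\mathcal F$, and $\Box[a]\mathit{reset}(c)\equiv\gamma_c$ for $c\in C$, with fluent formulas $\pi_o,\gamma_F,\gamma_c$ (static, not mentioning $\mathit{Poss}$); free variables are universally quantified, and $[a]$ refers to the situation after $a$ has occurred at any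 time. Let $A_\Sigma$ be the set of action names and $\mathcal P_\Sigma$ the set of primitive formulas over the symbols and names mentioned in $\Sigma$ (formulas $g(a)$ excluded). Let $\delta$ be a program (built from actions, tests of static sentences, sequence, choice, interleaving and iteration) and $w$ a world with $w\models\Sigma$. Let $\langle z,\nu,\rho\rangle\to_w\langle z',\nu',\rho'\rangle$ be the usual Golog transition relation in $w$, in which an action $a$ is performed after a delay $d\ge0$ if $w,z\models\mathit{Poss}(a)$ and $w,z,\nu+d\models g(a)$, with $z'=z\cdot(a,\mathrm{time}(z)+d)$, $\nu'(c)=0$ if $w,z'\models\mathit{reset}(c)$ and $\nu'(c)=\nu(c)+d$ otherwise. Let $\mathcal F^w$ be the set of final configurations and $\mathrm{sub}(\delta)$ the set of programs reachable from $(\langle\rangle,\vec0,\delta)$ in some world satisfying $\Sigma$. A symbolic trace is a finite sequence $s$ of triples $(a,g,Y)$ with $a\in A_\Sigma$, $g$ a clock formula over $C$ and $Y\subseteq C$. Its set of induced timed traces $\mathrm{tw}(s)$ consists of the $z$ with the same actions as $s$ for which there are transitions $\langle\langle\rangle,\vec0,\delta\rangle\to_w\cdots\to_w\langle z,\nu_n,\rho_n\rangle$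 with $\rho_i\in\mathrm{sub}(\delta)$ in which, in the $i$-th step with delay $d_i$, $\nu_{i-1}+d_i\models g_i$ and $\nu_i$ is $\nu_{i-1}+d_i$ with the clocks in $Y_i$ set to $0$. Let $\mathcal A$ be an alternating timed automaton (ATA) with a single clock over the alphabet $2^{\mathcal P_\Sigma}$ which is complete, i.e. each transition formula $\delta_{\mathcal A}(l,\sigma)$ has a model at each clock value (for instance a complete ATA for an MTL formula $\phi$ over $\mathcal P_\Sigma$). Write $G\overset{t}{\rightsquigarrow}G'$ and $G\overset{\sigma}{\to}G'$ for its flow and edge steps between configurations (finite sets of states). The synchronous product $\mathcal S$ has the states $((s,\nu,\rho),G)$ with $s$ a symbolic trace, $\nu\in\mathbb R_{\ge0}^C$, $\rho\in\mathrm{sub}(\delta)$ and $G$ a configuration of $\mathcal A$, the initial state $((\langle\rangle,\vec0,\delta),G_0)$, where $G_0$ is the initial configuration of $\mathcal A$, and transitions $((s,\nu,\rho),G)\xrightarrow{(a,g,Y)}((s\cdot(a,g,Y),\nu',\rho'),G')$ if $g=g_a$ and for some $t\ge0$: (i) there is $z\in\mathrm{tw}(s)$ such that, for $z'=z\cdot(a,\mathrm{time}(z)+t)$,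 $\langle z,\nu,\rho\rangle\to_w\langle z',\nu',\rho'\rangle$ and $Y=\{c\in C: w,z'\models\mathit{reset}(c)\}$; and (ii) $G\overset{t}{\rightsquigarrow}G^*\overset{F}{\to}G'$ with $F=\{f\in\mathcal P_\Sigma: w[f,z]=1\}$ for some $z\in\mathrm{tw}(s)$ and some $G^*$. For $K\in\mathbb N$ let the regions be $\{i\}$ ($0\le i\le K$), $(i,i+1)$ ($0\le i<K$) and $(K,\infty)$. Let $H(\nu,G)$ be the sequence obtained from the set $\{(c,\nu(c)):c\in C\}\cup G$ by grouping its elements by the fractional part of their values, listing the groups by increasing fractional part, and replacing each value by its region. The regionalized product $\mathcal T_\sim$ has the states $(s,\rho,H(\nu,G))$ for the states $((s,\nu,\rho),G)$ of $\mathcal S$, the initial state $(\langle\rangle,\delta,H(\vec0,G_0))$, and a transition $(s,\rho,h)\xrightarrow{(a,g,Y)}(s',\rho',h')$ iff $((s,\nu,\rho),G)\xrightarrow{(a,g,Y)}((s',\nu',\rho'),G')$ in $\mathcal S$ for some $\nu,G,\nu',G'$ with $H(\nu,G)=h$ and $H(\nu',G')=h'$. A state $((s,\nu,\rho),G)$ of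 $\mathcal S$ is final if $\langle z,\nu,\rho\rangle\in\mathcal F^w$ for some $z\in\mathrm{tw}(s)$; a state $(s,\rho,h)$ of $\mathcal T_\sim$ is final if $h=H(\nu,G)$ for a final state $((s,\nu,\rho),G)$. Let $\mathcal Z(\mathcal S)$ and $\mathcal Z(\mathcal T_\sim)$ be the unions of the sets $\mathrm{tw}(s)$ over all final states, with symbolic trace $s$, that are reachable from the respective initial state. The fluent trace $\psi(z)$ of a timed trace $z$ with prefixes $z_0,\dots,z_n$ is the timed word $(F_0,0),(F_1,t_1),\dots,(F_n,t_n)$ with $F_i=\{f\in\mathcal P_\Sigma:w[f,z_i]=1\}$ and $t_i=\mathrm{time}(z_i)$. A run of $\mathcal A$ on a timed word $(\sigma_0,\tau_0)\cdots(\sigma_k,\tau_k)$ is a sequence $G_0\overset{\sigma_0}{\to}G_1\overset{d_0}{\rightsquigarrow}G_2\overset{\sigma_1}{\to}\cdots\overset{\sigma_k}{\to}G_{2k+1}\overset{d_k}{\rightsquigarrow}G_{2k+2}$ from the initial configuration with $d_i=\tau_{i+1}-\tau_i$ for $i<k$. **Theorem.** For every $K\in\mathbb N$ (in particular the greatest constant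 mentioned in $\phi$) and every timed trace $z$: 1. if $z\in\mathcal Z(\mathcal T_\sim)$, then there is a run of $\mathcal A$ on the fluent trace $\psi(z)$; 2. $z\in\mathcal Z(\mathcal T_\sim)$ if and only if $z\in\mathcal Z(\mathcal S)$. -/

import Mathlib

namespace TESG

open scoped NNReal

/-! ### Sorts, standard names, terms, static situation formulas -/

/-- The three sorts of the language. -/
inductive Srt
  | obj
  | act
  | clk

/-- Standard names of sort object: countably many, with the rational numbers as a subsort. -/
inductive ObjName
  | name (n : ℕ)
  | rat (q : ℚ)

/-- Standard names of sort action: an action symbol (an index together with an arity, the length of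
`args`) applied to standard names of sort object. -/
structure ActName where
  sym : ℕ
  args : List ObjName

/-- Standard names of sort clock. -/
abbrev ClkName := ℕ

/-- The standard names of a given sort. -/
def Name : Srt → Type
  | .obj => ObjName
  | .act => ActName
  | .clk => ClkName

/-- A predicate symbol. Its arity is `ar.length`; each argument position takes objects or actions.
Fluent and rigid symbols are told apart where they are used. -/
structure Sym where
  idx : ℕ
  ar : List Srt
  no_clk : Srt.clk ∉ ar

/-- Terms whose free variables are those of the context `Γ` (de Bruijn indices). The closed terms
are exactly the standard names. -/
inductive Term (Γ : List Srt) : Srt → Type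
  | var (i : Fin Γ.length) : Term Γ (Γ.get i)
  | obj (n : ObjName) : Term Γ .obj
  | act (f : ℕ) (k : ℕ) (args : Fin k → Term Γ .obj) : Term Γ .act
  | clk (c : ClkName) : Term Γ .clk

/-- Static situation formulas with free variables in the context `Γ`; sentences have `Γ = []`. -/
inductive Form : List Srt → Type
  | flu {Γ : List Srt} (F : Sym) (args : ∀ i : Fin F.ar.length, Term Γ (F.ar.get i)) : Form Γ
  | rig {Γ : List Srt} (G : Sym) (args : ∀ i : Fin G.ar.length, Term Γ (G.ar.get i)) : Form Γ
  | poss {Γ : List Srt} (t : Term Γ .act) : Form Γ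
  | reset {Γ : List Srt} (t : Term Γ .clk) : Form Γ
  | eq {Γ : List Srt} {s : Srt} (hs : s ≠ .clk) (t u : Term Γ s) : Form Γ
  | and {Γ : List Srt} (φ ψ : Form Γ) : Form Γ
  | not {Γ : List Srt} (φ : Form Γ) : Form Γ
  | all {Γ : List Srt} (s : Srt) (φ : Form (s :: Γ)) : Form Γ

/-- `⊤`, written as `∀ x. x = x`. -/
def Form.top {Γ : List Srt} : Form Γ :=
  .all .obj (.eq (s := .obj) (by simp) (.var (Γ := .obj :: Γ) ⟨0, by simp⟩)
    (.var (Γ := .obj :: Γ) ⟨0, by simp⟩))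

/-- Non-logical symbols and standard names, used to speak of what a formula mentions. -/
inductive Symb
  | obj (n : ObjName)
  | act (a : ActName)
  | clk (c : ClkName)
  | flu (F : Sym)
  | rig (G : Sym)
  | poss
  | reset

/-- The standard names mentioned in a term. A closed action term is an action standard name. -/
def Term.mentions {Γ : List Srt} : {s : Srt} → Term Γ s → Set Symb
  | _, .var _ => ∅
  | _, .obj n => {.obj n}
  | _, .act f k args =>
      (⋃ i, (args i).mentions) ∪
        {x | ∃ n : Fin k → ObjName, (∀ i, args i = .obj (n i)) ∧ x = .act ⟨f, List.ofFn n⟩}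
  | _, .clk c => {.clk c}

/-- The symbols and standard names mentioned in a formula. -/
def Form.mentions : {Γ : List Srt} → Form Γ → Set Symb
  | _, .flu F args => {.flu F} ∪ ⋃ i, (args i).mentions
  | _, .rig G args => {.rig G} ∪ ⋃ i, (args i).mentions
  | _, .poss t => {.poss} ∪ t.mentions
  | _, .reset t => {.reset} ∪ t.mentions
  | _, .eq _ t u => t.mentions ∪ u.mentions
  | _, .and φ ψ => φ.mentions ∪ ψ.mentions
  | _, .not φ => φ.mentions
  | _, .all _ φ => φ.mentions

/-! ### Clock formulas -/

/-- The comparison operators. -/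
inductive Cmp
  | lt
  | le
  | eq
  | ge
  | gt

/-- The meaning of a comparison operator. -/
def Cmp.holds : Cmp → ℝ≥0 → ℝ≥0 → Prop
  | .lt, x, y => x < y
  | .le, x, y => x ≤ y
  | .eq, x, y => x = y
  | .ge, x, y => y ≤ x
  | .gt, x, y => y < x

/-- Clock valuations over a finite set of clocks. -/
abbrev Val (C : Finset ClkName) := C → ℝ≥0

/-- The valuation `ν + d`. -/
def Val.delay {C : Finset ClkName} (ν : Val C) (d : ℝ≥0) : Val C := fun c => ν c + d

/-- Clock formulas over `C`. -/
inductive ClockForm (C : Finset ClkName)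
  | top
  | cmp (c : C) (op : Cmp) (r : ℕ)
  | and (g h : ClockForm C)
  | box (g : ClockForm C)

/-- Truth of clock formulas; the truth value does not depend on world and trace. -/
def ClockForm.sat {C : Finset ClkName} : ClockForm C → Val C → Prop
  | .top, _ => True
  | .cmp c op r, ν => op.holds (ν c) r
  | .and g h, ν => g.sat ν ∧ h.sat ν
  | .box g, ν => ∀ ν' : Val C, ν ≤ ν' → g.sat ν'

/-! ### Timed traces and worlds -/

/-- Finite timed traces: sequences of action standard names with non-decreasing time stamps. -/
def Trace := {l : List (ActName × ℝ≥0) // l.Pairwise fun p q => p.2 ≤ q.2}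

/-- The empty trace. -/
def Trace.empty : Trace := ⟨[], List.Pairwise.nil⟩

/-- The time stamp of the last action, and `0` for the empty trace. -/
def Trace.time (z : Trace) : ℝ≥0 := (z.1.getLast?.map Prod.snd).getD 0

theorem Trace.le_time (z : Trace) : ∀ p ∈ z.1, p.2 ≤ z.time := by
  obtain ⟨l, hl⟩ := z
  intro p hp
  rcases List.eq_nil_or_concat l with h | ⟨l', q, h⟩
  · subst h
    simp at hp
  · subst h
    simp only [List.concat_eq_append, List.mem_append, List.mem_singleton] at hp
    simp only [List.concat_eq_append] at hl
    simp only [Trace.time, List.concat_eq_append, List.getLast?_append, List.getLast?_singleton,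
      Option.some_or, Option.map_some, Option.getD_some]
    rcases hp with hp | hp
    · exact (List.pairwise_append.1 hl).2.2 p hp q (by simp)
    · rw [hp]

/-- The trace `z · (a, time z + d)`. Every one-action extension of `z` is of this form. -/
def Trace.snoc (z : Trace) (a : ActName) (d : ℝ≥0) : Trace :=
  ⟨z.1 ++ [(a, z.time + d)], by
    refine List.pairwise_append.2 ⟨z.2, List.pairwise_singleton _ _, ?_⟩
    intro p hp q hq
    rw [List.mem_singleton] at hq
    subst hq
    exact (z.le_time p hp).trans (by simp)⟩

/-- The prefix of length `i` of a trace. -/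
def Trace.take (z : Trace) (i : ℕ) : Trace := ⟨z.1.take i, z.2.sublist (List.take_sublist i z.1)⟩

/-- An assignment of standard names to the variables of a context. -/
abbrev Env (Γ : List Srt) := ∀ i : Fin Γ.length, Name (Γ.get i)

/-- The assignment for the empty context. -/
def Env.nil : Env [] := fun i => i.elim0

/-- Extension of an assignment by the value of one more variable. -/
def Env.cons {s : Srt} {Γ : List Srt} (n : Name s) (e : Env Γ) : Env (s :: Γ) :=
  fun i => Fin.cases (motive := fun i => Name ((s :: Γ).get i)) n e i

/-- Primitive formulas: predicate symbols with standard names as arguments. -/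
inductive Prim
  | flu (F : Sym) (args : Env F.ar)
  | rig (G : Sym) (args : Env G.ar)
  | poss (a : ActName)
  | reset (c : ClkName)

/-- A standard name as a symbol. -/
def Name.symb : {s : Srt} → Name s → Symb
  | .obj, n => .obj n
  | .act, a => .act a
  | .clk, c => .clk c

/-- The symbols and standard names mentioned in a primitive formula. -/
def Prim.mentions : Prim → Set Symb
  | .flu F args => {.flu F} ∪ Set.range fun i => (args i).symb
  | .rig G args => {.rig G} ∪ Set.range fun i => (args i).symb
  | .poss a => {.poss, .act a}
  | .reset c => {.reset, .clk c}

/-- A world fixes the truth of the primitive formulas after every timed trace; rigid predicates do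
not change. The distinguished predicate `g` of the clock constraints of an action is evaluated at a
clock valuation as well, and is kept apart for this reason. -/
structure World (C : Finset ClkName) where
  val : Prim → Trace → Prop
  rigid : ∀ (G : Sym) (args : Env G.ar) (z z' : Trace), val (.rig G args) z ↔ val (.rig G args) z'
  guard : ActName → Trace → Val C → Prop

/-- The standard name denoted by a term. -/
def Term.eval {Γ : List Srt} (e : Env Γ) : {s : Srt} → Term Γ s → Name s
  | _, .var i => e i
  | _, .obj n => n
  | _, .act f _ args => (⟨f, List.ofFn fun i => (args i).eval e⟩ : ActName)
  | _, .clk c => c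

/-- Truth of a static situation formula in world `w` after the trace `z`. Quantifiers range over
the standard names of their sort. -/
def Form.sat {C : Finset ClkName} (w : World C) (z : Trace) : {Γ : List Srt} → Env Γ → Form Γ → Prop
  | _, e, .flu F args => w.val (.flu F fun i => (args i).eval e) z
  | _, e, .rig G args => w.val (.rig G fun i => (args i).eval e) z
  | _, e, .poss t => w.val (.poss (t.eval e)) z
  | _, e, .reset t => w.val (.reset (t.eval e)) z
  | _, e, .eq _ t u => t.eval e = u.eval e
  | _, e, .and φ ψ => φ.sat w z e ∧ ψ.sat w z e
  | _, e, .not φ => ¬ φ.sat w z e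
  | _, e, .all s φ => ∀ n : Name s, φ.sat w z (e.cons n)

/-! ### Programs and their transition semantics -/

/-- (Closed) program expressions: actions, tests of static sentences, sequence, nondeterministic
branching, interleaved concurrency, and nondeterministic iteration. -/
inductive Prog
  | act (a : ActName)
  | test (α : Form [])
  | seq (δ₁ δ₂ : Prog)
  | choice (δ₁ δ₂ : Prog)
  | par (δ₁ δ₂ : Prog)
  | star (δ : Prog)

/-- The empty program. -/
def Prog.nil : Prog := .test Form.top

/-- The final configurations of a world. -/
inductive Final {C : Finset ClkName} (w : World C) : Trace → Val C → Prog → Prop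
  | test (z ν α) : α.sat w z Env.nil → Final w z ν (.test α)
  | seq (z ν δ₁ δ₂) : Final w z ν δ₁ → Final w z ν δ₂ → Final w z ν (.seq δ₁ δ₂)
  | choice_left (z ν δ₁ δ₂) : Final w z ν δ₁ → Final w z ν (.choice δ₁ δ₂)
  | choice_right (z ν δ₁ δ₂) : Final w z ν δ₂ → Final w z ν (.choice δ₁ δ₂)
  | star (z ν δ) : Final w z ν (.star δ)
  | par (z ν δ₁ δ₂) : Final w z ν δ₁ → Final w z ν δ₂ → Final w z ν (.par δ₁ δ₂)

/-- The transition relation between configurations `⟨z, ν, ρ⟩` in a world. -/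
inductive Step {C : Finset ClkName} (w : World C) :
    Trace → Val C → Prog → Trace → Val C → Prog → Prop
  | act (z : Trace) (ν ν' : Val C) (a : ActName) (d : ℝ≥0) :
      w.val (.poss a) z →
      w.guard a z (ν.delay d) →
      (∀ c : C, w.val (.reset c) (z.snoc a d) → ν' c = 0) →
      (∀ c : C, ¬ w.val (.reset c) (z.snoc a d) → ν' c = ν c + d) →
      Step w z ν (.act a) (z.snoc a d) ν' .nil
  | seq_left (z ν δ₁ δ₂ z' ν' γ) :
      Step w z ν δ₁ z' ν' γ → Step w z ν (.seq δ₁ δ₂) z' ν' (.seq γ δ₂)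
  | seq_right (z ν δ₁ δ₂ z' ν' δ') :
      Final w z ν δ₁ → Step w z ν δ₂ z' ν' δ' → Step w z ν (.seq δ₁ δ₂) z' ν' δ'
  | choice_left (z ν δ₁ δ₂ z' ν' δ') :
      Step w z ν δ₁ z' ν' δ' → Step w z ν (.choice δ₁ δ₂) z' ν' δ'
  | choice_right (z ν δ₁ δ₂ z' ν' δ') :
      Step w z ν δ₂ z' ν' δ' → Step w z ν (.choice δ₁ δ₂) z' ν' δ'
  | star (z ν δ z' ν' γ) :
      Step w z ν δ z' ν' γ → Step w z ν (.star δ) z' ν' (.seq γ (.star δ))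
  | par_left (z ν δ₁ δ₂ z' ν' δ') :
      Step w z ν δ₁ z' ν' δ' → Step w z ν (.par δ₁ δ₂) z' ν' (.par δ' δ₂)
  | par_right (z ν δ₁ δ₂ z' ν' δ') :
      Step w z ν δ₂ z' ν' δ' → Step w z ν (.par δ₁ δ₂) z' ν' (.par δ₁ δ')

/-- Reachability of `⟨z', ν', ρ'⟩` from `⟨z, ν, ρ⟩` by finitely many transitions. -/
def Steps {C : Finset ClkName} (w : World C) (x y : Trace × Val C × Prog) : Prop :=
  Relation.ReflTransGen
    (fun x y : Trace × Val C × Prog => Step w x.1 x.2.1 x.2.2 y.1 y.2.1 y.2.2) x y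

/-! ### Basic action theories -/

/-- A basic action theory over the finite sets `Fl` of fluent predicates and `C` of clocks.
* `init` is the set of sentences on the initial situation.
* `pre` lists the formulas `π_o` of the axiom `□ Poss(a) ≡ ⋁_o π_o`, with free variable `a`.
* `guard a = some g_a` if there is an axiom `□ g(a) ≡ g_a`; an action without an axiom is
  unconstrained.
* `post F` is the right-hand side `γ_F` of `□ [a]F(x) ≡ γ_F`, with free variables `a` and `x`.
* `reset c` is the right-hand side `γ_c` of `□ [a]reset(c) ≡ γ_c`, with free variable `a`. -/
structure BAT (Fl : Finset Sym) (C : Finset ClkName) where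
  init : Set (Form [])
  pre : List (Form [.act])
  guard : ActName → Option (ClockForm C)
  post : ∀ F ∈ Fl, Form (.act :: F.ar)
  reset : C → Form [.act]
  /-- All these formulas are fluent formulas, i.e. do not mention `Poss`. -/
  init_fluent : ∀ φ ∈ init, Symb.poss ∉ φ.mentions
  pre_fluent : ∀ φ ∈ pre, Symb.poss ∉ φ.mentions
  post_fluent : ∀ F hF, Symb.poss ∉ (post F hF).mentions
  reset_fluent : ∀ c, Symb.poss ∉ (reset c).mentions
  /-- Only fluents in `Fl` and clocks in `C` are mentioned. -/
  init_sig : ∀ φ ∈ init, (∀ F, Symb.flu F ∈ φ.mentions → F ∈ Fl) ∧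
    (∀ c, Symb.clk c ∈ φ.mentions → c ∈ C)
  pre_sig : ∀ φ ∈ pre, (∀ F, Symb.flu F ∈ φ.mentions → F ∈ Fl) ∧
    (∀ c, Symb.clk c ∈ φ.mentions → c ∈ C)
  post_sig : ∀ F hF, (∀ F', Symb.flu F' ∈ (post F hF).mentions → F' ∈ Fl) ∧
    (∀ c, Symb.clk c ∈ (post F hF).mentions → c ∈ C)
  reset_sig : ∀ c, (∀ F, Symb.flu F ∈ (reset c).mentions → F ∈ Fl) ∧
    (∀ c', Symb.clk c' ∈ (reset c).mentions → c' ∈ C)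

section

variable {Fl : Finset Sym} {C : Finset ClkName}

/-- The guard `g_a` of an action. -/
def BAT.guardOf (B : BAT Fl C) (a : ActName) : ClockForm C := (B.guard a).getD .top

/-- The symbols and standard names mentioned in the axioms. -/
inductive BAT.Mentions (B : BAT Fl C) : Symb → Prop
  | init (φ x) : φ ∈ B.init → x ∈ φ.mentions → B.Mentions x
  | poss : B.Mentions .poss
  | pre (φ x) : φ ∈ B.pre → x ∈ φ.mentions → B.Mentions x
  | guard_act (a) : (B.guard a).isSome → B.Mentions (.act a)
  | guard_obj (a n) : (B.guard a).isSome → n ∈ a.args → B.Mentions (.obj n)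
  | flu (F) : F ∈ Fl → B.Mentions (.flu F)
  | post (F hF x) : x ∈ (B.post F hF).mentions → B.Mentions x
  | clk (c) : c ∈ C → B.Mentions (.clk c)
  | reset (c) : c ∈ C → B.Mentions .reset
  | reset_mem (c x) : x ∈ (B.reset c).mentions → B.Mentions x

/-- The primitive formulas restricted to the theory. -/
abbrev BAT.Primes (B : BAT Fl C) := {p : Prim // ∀ x ∈ p.mentions, B.Mentions x}

/-- The action standard names mentioned in the theory. -/
abbrev BAT.Acts (B : BAT Fl C) := {a : ActName // B.Mentions (.act a)}

/-- The world satisfies the theory. The free variables of the axioms are universally quantified,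
and `[a]` refers to the situation after the occurrence of `a` at any time. -/
structure World.Models (w : World C) (B : BAT Fl C) : Prop where
  init : ∀ φ ∈ B.init, φ.sat w Trace.empty Env.nil
  pre : ∀ (z : Trace) (a : ActName),
    w.val (.poss a) z ↔ ∃ π ∈ B.pre, π.sat w z (Env.nil.cons (s := .act) a)
  guard : ∀ (a : ActName) (z : Trace) (ν : Val C), w.guard a z ν ↔ (B.guardOf a).sat ν
  post : ∀ (F : Sym) (hF : F ∈ Fl) (z : Trace) (a : ActName) (d : ℝ≥0) (n : Env F.ar),
    w.val (.flu F n) (z.snoc a d) ↔ (B.post F hF).sat w z (n.cons (s := .act) a)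
  reset : ∀ (c : C) (z : Trace) (a : ActName) (d : ℝ≥0),
    w.val (.reset c) (z.snoc a d) ↔ (B.reset c).sat w z (Env.nil.cons (s := .act) a)

/-- The reachable subprograms of `δ`. -/
def BAT.sub (B : BAT Fl C) (δ : Prog) : Set Prog :=
  {ρ | ∃ w : World C, w.Models B ∧ ∃ z ν, Steps w (Trace.empty, (fun _ => 0), δ) (z, ν, ρ)}

/-! ### Symbolic traces and symbolic execution -/

/-- Symbolic actions `(a, g, Y)`: an action, a guard, and the set of clocks to be reset. -/
structure BAT.Label (B : BAT Fl C) where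
  act : B.Acts
  guard : ClockForm C
  resets : Set C

/-- `SymRun w B δ s z ν ρ`: there are valuations `ν₀ = 0, …, νₙ = ν`, compatible with the guards and
the reset sets of the symbolic trace `s`, and subprograms `ρ₀ = δ, …, ρₙ = ρ`, such that `w` admits
the transitions `⟨⟨⟩, ν₀, ρ₀⟩ → … → ⟨z, νₙ, ρₙ⟩`, taking the actions of `s`. -/
inductive SymRun (w : World C) (B : BAT Fl C) (δ : Prog) :
    List B.Label → Trace → Val C → Prog → Prop
  | nil : SymRun w B δ [] Trace.empty (fun _ => 0) δ
  | snoc (s : List B.Label) (z : Trace) (ν ν' : Val C) (ρ ρ' : Prog) (x : B.Label) (d : ℝ≥0) :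
      SymRun w B δ s z ν ρ →
      Step w z ν ρ (z.snoc x.act d) ν' ρ' →
      ρ' ∈ B.sub δ →
      x.guard.sat (ν.delay d) →
      (∀ c ∈ x.resets, ν' c = 0) →
      (∀ c ∉ x.resets, ν' c = ν c + d) →
      SymRun w B δ (s ++ [x]) (z.snoc x.act d) ν' ρ'

/-- The timed traces induced by a symbolic trace. -/
def tw (w : World C) (B : BAT Fl C) (δ : Prog) (s : List B.Label) : Set Trace :=
  {z | ∃ ν ρ, SymRun w B δ s z ν ρ}

/-- A labelled transition system with an initial state. -/
structure LTS (Lab : Type) where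
  State : Type
  init : State
  trans : State → Lab → State → Prop

/-- The end states of the finite paths from the initial state. -/
def LTS.Reachable {Lab : Type} (T : LTS Lab) (q : T.State) : Prop :=
  Relation.ReflTransGen (fun q q' => ∃ x, T.trans q x q') T.init q

/-- States of the symbolic execution. -/
structure SymState (B : BAT Fl C) (δ : Prog) where
  trace : List B.Label
  val : Val C
  prog : Prog
  mem_sub : prog ∈ B.sub δ

/-- The state is a final configuration for some induced timed trace. -/
def SymState.IsFinal (w : World C) {B : BAT Fl C} {δ : Prog} (e : SymState B δ) : Prop :=
  ∃ z ∈ tw w B δ e.trace, Final w z e.val e.prog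

/-- The transition of the symbolic execution from `e` to `e'` with label `x`, where `t` is the
time that passes. -/
def SymStep (w : World C) {B : BAT Fl C} {δ : Prog} (t : ℝ≥0)
    (e : SymState B δ) (x : B.Label) (e' : SymState B δ) : Prop :=
  e'.trace = e.trace ++ [x] ∧
  x.guard = B.guardOf x.act ∧
  ∃ z ∈ tw w B δ e.trace,
    Step w z e.val e.prog (z.snoc x.act t) e'.val e'.prog ∧
    ∀ c : C, c ∈ x.resets ↔ w.val (.reset c) (z.snoc x.act t)

/-- The initial state of the symbolic execution. -/
def SymState.start (w : World C) (B : BAT Fl C) (hw : w.Models B) (δ : Prog) : SymState B δ :=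
  ⟨[], fun _ => 0, δ, w, hw, Trace.empty, fun _ => 0, Relation.ReflTransGen.refl⟩

/-- The symbolic execution of the program `(B, δ)`. -/
def symbolicExecution (w : World C) (B : BAT Fl C) (hw : w.Models B) (δ : Prog) : LTS B.Label where
  State := SymState B δ
  init := SymState.start w B hw δ
  trans e x e' := ∃ t, SymStep w t e x e'

end

/-! ### Alternating timed automata -/

/-- The formulas over a set of locations that occur in transition functions. -/
inductive LocForm (L : Type)
  | top
  | bot
  | and (φ ψ : LocForm L)
  | or (φ ψ : LocForm L)
  | loc (l : L)
  | cmp (op : Cmp) (k : ℕ)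
  | reset (φ : LocForm L)

/-- `(M, v) ⊨ φ`. -/
def LocForm.sat {L : Type} (M : Set (L × ℝ≥0)) : ℝ≥0 → LocForm L → Prop
  | _, .top => True
  | _, .bot => False
  | v, .and φ ψ => φ.sat M v ∧ ψ.sat M v
  | v, .or φ ψ => φ.sat M v ∨ ψ.sat M v
  | v, .loc l => (l, v) ∈ M
  | v, .cmp op k => op.holds v k
  | _, .reset φ => φ.sat M 0

/-- `M` is a minimal model of `φ` at the clock value `v`. -/
def LocForm.IsMinimalModel {L : Type} (M : Set (L × ℝ≥0)) (v : ℝ≥0) (φ : LocForm L) : Prop :=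
  φ.sat M v ∧ ∀ N, N ⊂ M → ¬ φ.sat N v

/-- Alternating timed automata, with a single clock. -/
structure ATA (Alph : Type) where
  Loc : Type
  finite_loc : Finite Loc
  init : Loc
  acc : Set Loc
  δ : Loc → Alph → LocForm Loc

/-- Configurations: finite sets of states, i.e. of pairs of a location and a clock value. -/
abbrev ATA.Config {Alph : Type} (A : ATA Alph) := {G : Set (A.Loc × ℝ≥0) // G.Finite}

/-- The initial configuration. -/
def ATA.start {Alph : Type} (A : ATA Alph) : A.Config := ⟨{(A.init, 0)}, Set.finite_singleton _⟩

/-- Flow steps: `t` time units pass. -/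
def ATA.Flow {Alph : Type} (A : ATA Alph) (t : ℝ≥0) (G G' : A.Config) : Prop :=
  G'.1 = {q | ∃ p ∈ G.1, q = (p.1, p.2 + t)}

/-- Edge steps: the letter `σ` is read. -/
def ATA.Edge {Alph : Type} (A : ATA Alph) (σ : Alph) (G G' : A.Config) : Prop :=
  ∃ M : A.Loc × ℝ≥0 → Set (A.Loc × ℝ≥0),
    (∀ q ∈ G.1, (A.δ q.1 σ).IsMinimalModel (M q) q.2) ∧ G'.1 = ⋃ q ∈ G.1, M q

/-- The automaton is complete: in every state, every letter can be read. -/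
def ATA.Complete {Alph : Type} (A : ATA Alph) : Prop :=
  ∀ (l : A.Loc) (σ : Alph) (v : ℝ≥0), ∃ M, (A.δ l σ).sat M v

/-- There is a run of the automaton on the finite timed word `u = (σ₀, τ₀) … (σₖ, τₖ)`, i.e. a
sequence of edge steps and flow steps `G₀ →^{σ₀} G₁ ⇝^{d₀} G₂ → … →^{σₖ} G₂ₖ₊₁ ⇝^{dₖ} G₂ₖ₊₂` from the
initial configuration, where `dᵢ = τᵢ₊₁ - τᵢ` for `i < k`. -/
def ATA.HasRun {Alph : Type} (A : ATA Alph) (u : List (Alph × ℝ≥0)) : Prop :=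
  ∃ (G : ℕ → A.Config) (d : ℕ → ℝ≥0), G 0 = A.start ∧
    (∀ (i : ℕ) (h : i < u.length),
      A.Edge (u[i]).1 (G (2 * i)) (G (2 * i + 1)) ∧ A.Flow (d i) (G (2 * i + 1)) (G (2 * i + 2))) ∧
    ∀ (i : ℕ) (h : i + 1 < u.length), (u[i + 1]).2 = (u[i]).2 + d i

section

variable {Fl : Finset Sym} {C : Finset ClkName}

/-- The set of primitive formulas of the theory that hold after the trace. -/
def fluentSet (w : World C) (B : BAT Fl C) (z : Trace) : Set B.Primes := {f | w.val f.1 z}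

/-- The fluent trace of a timed trace. -/
def fluentTrace (w : World C) (B : BAT Fl C) (z : Trace) : List (Set B.Primes × ℝ≥0) :=
  (List.range (z.1.length + 1)).map fun i => (fluentSet w B (z.take i), (z.take i).time)

/-! ### The synchronous product -/

/-- The synchronous product of the symbolic execution and an automaton. -/
def syncProduct (w : World C) (B : BAT Fl C) (hw : w.Models B) (δ : Prog)
    (A : ATA (Set B.Primes)) : LTS B.Label where
  State := (symbolicExecution w B hw δ).State × A.Config
  init := ((symbolicExecution w B hw δ).init, A.start)
  trans q x q' := ∃ t, SymStep w t q.1 x q'.1 ∧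
    ∃ G : A.Config, A.Flow t q.2 G ∧ ∃ z ∈ tw w B δ q.1.trace, A.Edge (fluentSet w B z) G q'.2

/-- The timed traces induced by the paths of the synchronous product that end in a final
configuration. -/
def syncTraces (w : World C) (B : BAT Fl C) (hw : w.Models B) (δ : Prog)
    (A : ATA (Set B.Primes)) : Set Trace :=
  {z | ∃ q : SymState B δ × A.Config, (syncProduct w B hw δ A).Reachable q ∧
    q.1.IsFinal w ∧ z ∈ tw w B δ q.1.trace}

/-! ### Regionalization -/

open Classical in
/-- The index of the region of `u` with respect to the constant `K`: the regions are
`r_{2i} = {i}` for `i ≤ K`, `r_{2i+1} = (i, i+1)` for `i < K`, and `r_{2K+1} = (K, ∞)`. -/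
noncomputable def reg (K : ℕ) (u : ℝ≥0) : ℕ :=
  if (K : ℝ≥0) < u then 2 * K + 1
  else if u = (⌊u⌋₊ : ℝ≥0) then 2 * ⌊u⌋₊
  else 2 * ⌊u⌋₊ + 1

/-- The alphabet of sets of pairs of a clock or a location and (the index of) a region. -/
abbrev Lam (C : Finset ClkName) (L : Type) := Set ((C ⊕ L) × ℕ)

/-- The clocks and the states of the automaton with their values: `G_ν ∪ G`. -/
def valued {L : Type} (ν : Val C) (G : Set (L × ℝ≥0)) : Set ((C ⊕ L) × ℝ≥0) :=
  (Set.range fun c => (Sum.inl c, ν c)) ∪ (fun q => (Sum.inr q.1, q.2)) '' G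

theorem valued_finite {L : Type} (ν : Val C) {G : Set (L × ℝ≥0)} (hG : G.Finite) :
    (valued ν G).Finite := (Set.finite_range _).union (hG.image _)

/-- The canonical representation `H(ν, G)`: the elements of `G_ν ∪ G` are grouped by the fractional
part of their value, the groups are listed by increasing fractional part, and values are replaced
by regions. -/
noncomputable def canon {L : Type} (K : ℕ) (ν : Val C) (G : {G : Set (L × ℝ≥0) // G.Finite}) :
    List (Lam C L) :=
  (((valued_finite ν G.2).image fun p => Int.fract (p.2 : ℝ)).toFinset.sort (· ≤ ·)).map fun r =>
    {y | ∃ p ∈ valued ν G.1, Int.fract (p.2 : ℝ) = r ∧ y = (p.1, reg K p.2)}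

/-- States of the regionalized synchronous product: the triples `(s, ρ, H(ν, G))` for the states
`((s, ν, ρ), G)` of the synchronous product. -/
structure RegState (K : ℕ) (B : BAT Fl C) (δ : Prog) (A : ATA (Set B.Primes)) where
  trace : List B.Label
  prog : Prog
  h : List (Lam C A.Loc)
  mem : ∃ (e : SymState B δ) (G : A.Config), e.trace = trace ∧ e.prog = prog ∧ canon K e.val G = h

/-- The triple `(s, ρ, H(ν, G))` of the state `((s, ν, ρ), G)`. -/
noncomputable def RegState.mk' (K : ℕ) {B : BAT Fl C} {δ : Prog} {A : ATA (Set B.Primes)}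
    (q : SymState B δ × A.Config) : RegState K B δ A :=
  ⟨q.1.trace, q.1.prog, canon K q.1.val q.2, q.1, q.2, rfl, rfl, rfl⟩

/-- The regionalized synchronous product (discrete quotient). -/
noncomputable def regProduct (K : ℕ) (w : World C) (B : BAT Fl C) (hw : w.Models B) (δ : Prog)
    (A : ATA (Set B.Primes)) : LTS B.Label where
  State := RegState K B δ A
  init := RegState.mk' K (syncProduct w B hw δ A).init
  trans r x r' := ∃ q q' : SymState B δ × A.Config,
    RegState.mk' K q = r ∧ (syncProduct w B hw δ A).trans q x q' ∧ RegState.mk' K q' = r'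

/-- The timed traces induced by the paths of the regionalized product that end in a final
configuration, i.e. in the class of a final configuration of the synchronous product. -/
def regTraces (K : ℕ) (w : World C) (B : BAT Fl C) (hw : w.Models B) (δ : Prog)
    (A : ATA (Set B.Primes)) : Set Trace :=
  {z | ∃ r : RegState K B δ A, (regProduct K w B hw δ A).Reachable r ∧
    (∃ q : SymState B δ × A.Config, RegState.mk' K q = r ∧ q.1.IsFinal w) ∧
    z ∈ tw w B δ r.trace}

end

end TESG

namespace TESG

open scoped NNReal

/-! ### Minimal models and edge steps of complete automata -/

/-! Part 1 is completeness of the automaton: every state has a finite minimal model for every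
letter, so edge and flow steps can be chained along any timed word with non-decreasing times
(`ATA.Complete.hasRun`), and a fluent trace is such a word.

For part 2, paths of the synchronous product project to the regionalized product. The converse lifts
a path of the regionalized product and rests on no bisimulation between regions, which is why `K` is
arbitrary. Consecutive transitions of such a path may use representatives with different clock
values, but these agree on symbolic trace and program. The clock values can therefore be replaced by
those of an actual execution of the symbolic trace: executability of an action depends on the clocks
only through its guard, which the label records and the execution satisfies, and the resets do not
depend on the delay (`Step.of_val`). The automaton component is chosen anew at each step by
completeness. The result is `regProduct.exists_reachable`. Finality carries over because it ignores
clock values (`Final.of_val`). -/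

theorem LocForm.sat_mono {L : Type} {M N : Set (L × ℝ≥0)} (h : M ⊆ N) (φ : LocForm L) :
    ∀ {v : ℝ≥0}, φ.sat M v → φ.sat N v := by
  induction φ with
  | top => exact id
  | bot => exact id
  | and φ ψ hφ hψ => exact fun H => ⟨hφ H.1, hψ H.2⟩
  | or φ ψ hφ hψ => exact fun H => H.imp hφ hψ
  | loc l => exact fun H => h H
  | cmp op k => exact id
  | reset φ hφ => exact fun H => hφ (v := 0) H

/-- Only the finitely many location atoms needed to witness truth have to be kept. This matters
because completeness may provide an infinite model, while configurations are finite. -/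
theorem LocForm.exists_finite_model {L : Type} {M : Set (L × ℝ≥0)} (φ : LocForm L) :
    ∀ {v : ℝ≥0}, φ.sat M v → ∃ N : Set (L × ℝ≥0), N.Finite ∧ φ.sat N v := by
  induction φ with
  | top => exact fun _ => ⟨∅, Set.finite_empty, trivial⟩
  | bot => exact fun H => H.elim
  | and φ ψ hφ hψ =>
    intro v H
    obtain ⟨N, hN, hNφ⟩ := hφ H.1
    obtain ⟨N', hN', hNψ⟩ := hψ H.2
    exact ⟨N ∪ N', hN.union hN', sat_mono Set.subset_union_left φ hNφ,
      sat_mono Set.subset_union_right ψ hNψ⟩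
  | or φ ψ hφ hψ =>
    rintro v (H | H)
    · obtain ⟨N, hN, hNφ⟩ := hφ H
      exact ⟨N, hN, Or.inl hNφ⟩
    · obtain ⟨N, hN, hNψ⟩ := hψ H
      exact ⟨N, hN, Or.inr hNψ⟩
  | loc l => exact fun {v} _ => ⟨{(l, v)}, Set.finite_singleton _, rfl⟩
  | cmp op k => exact fun H => ⟨∅, Set.finite_empty, H⟩
  | reset φ hφ => exact fun H => hφ (v := 0) H

theorem LocForm.exists_finite_minimalModel {L : Type} {M : Set (L × ℝ≥0)} {v : ℝ≥0}
    {φ : LocForm L} (h : φ.sat M v) :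
    ∃ N : Set (L × ℝ≥0), N.Finite ∧ φ.IsMinimalModel N v := by
  obtain ⟨N, hN, hNφ⟩ := φ.exists_finite_model h
  obtain ⟨P, hP⟩ := (hN.finite_subsets.subset
    (fun P (hP : P ⊆ N ∧ φ.sat P v) => hP.1)).exists_minimal ⟨N, subset_rfl, hNφ⟩
  -- A proper subset of `P` still lies in `N`, so minimality among the models inside `N` is
  -- minimality among all models.
  exact ⟨P, hN.subset hP.1.1, hP.1.2, fun Q hQ hQφ =>
    hQ.2 (hP.2 ⟨hQ.1.trans hP.1.1, hQφ⟩ hQ.1)⟩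

theorem ATA.Complete.exists_edge {Alph : Type} {A : ATA Alph} (hA : A.Complete) (σ : Alph)
    (G : A.Config) : ∃ G', A.Edge σ G G' := by
  have h (q : A.Loc × ℝ≥0) :
      ∃ N : Set (A.Loc × ℝ≥0), N.Finite ∧ (A.δ q.1 σ).IsMinimalModel N q.2 :=
    let ⟨_, hM⟩ := hA q.1 σ q.2
    LocForm.exists_finite_minimalModel hM
  choose N hfin hmin using h
  exact ⟨⟨⋃ q ∈ G.1, N q, G.2.biUnion fun q _ => hfin q⟩, N, fun q _ => hmin q, rfl⟩

theorem ATA.exists_flow {Alph : Type} (A : ATA Alph) (t : ℝ≥0) (G : A.Config) :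
    ∃ G', A.Flow t G G' := by
  refine ⟨⟨(fun p => (p.1, p.2 + t)) '' G.1, G.2.image _⟩, ?_⟩
  ext q
  simp only [Set.mem_image, Set.mem_ofPred_eq, eq_comm]

/-- A complete automaton has a run on every timed word with non-decreasing times. -/
theorem ATA.Complete.hasRun {Alph : Type} {A : ATA Alph} (hA : A.Complete)
    {u : List (Alph × ℝ≥0)} (hu : ∀ (i : ℕ) (h : i + 1 < u.length), (u[i]).2 ≤ (u[i + 1]).2) :
    A.HasRun u := by
  choose E hE using hA.exists_edge
  choose D hD using A.exists_flow
  rcases u.eq_nil_or_concat with rfl | ⟨u', p, rfl⟩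
  · exact ⟨fun _ => A.start, fun _ => 0, rfl, fun i h => absurd h (by simp),
      fun i h => absurd h (by simp)⟩
  -- Of the decomposition only `p` is still needed, as the default value for out-of-range positions.
  generalize u'.concat p = u at hu
  let σ (i : ℕ) : Alph := (u.getD i p).1
  -- Truncated subtraction; monotonicity of the times makes it exact at inner positions. The delay
  -- after the last letter is unconstrained.
  let d (i : ℕ) : ℝ≥0 := (u.getD (i + 1) p).2 - (u.getD i p).2
  -- `H i` is the configuration `G₂ᵢ` before the `i`-th letter is read; the odd positions are filled
  -- in by the edge step.
  let H : ℕ → A.Config := fun i => Nat.rec A.start (fun i G => D (d i) (E (σ i) G)) i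
  refine ⟨fun n => if n % 2 = 0 then H (n / 2) else E (σ (n / 2)) (H (n / 2)), d, rfl, ?_, ?_⟩
  · intro i h
    have h₁ : (2 * i + 1) / 2 = i := by omega
    have h₂ : (2 * i + 2) / 2 = i + 1 := by omega
    have hσ : (u[i]).1 = σ i := by simp [σ, h]
    simp only [Nat.mul_mod_right, Nat.mul_add_mod, h₁, h₂, hσ]
    simp only [Nat.mul_div_cancel_left i two_pos, ↓reduceIte, Nat.one_mod, one_ne_zero]
    exact ⟨hE _ _, hD _ _⟩
  · intro i h
    have hi : i < u.length := by omega
    simp only [d, List.getD_eq_getElem _ _ h, List.getD_eq_getElem _ _ hi]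
    exact (add_tsub_cancel_of_le (hu i h)).symm

/-! ### Fluent traces -/

theorem Trace.time_take_mono (z : Trace) {i j : ℕ} (hij : i ≤ j) :
    (z.take i).time ≤ (z.take j).time := by
  by_cases h : (z.take i).1 = []
  · have h0 : (z.take i).time = 0 := by rw [Trace.time, h]; rfl
    exact h0 ▸ zero_le
  · have hlast : (z.take i).time = ((z.take i).1.getLast h).2 := by
      rw [Trace.time, List.getLast?_eq_getLast_of_ne_nil h]
      rfl
    rw [hlast]
    -- The last action of the shorter prefix also occurs in the longer one.
    exact (z.take j).le_time _ ((List.take_sublist_take_left hij).subset (List.getLast_mem h))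

section

variable {Fl : Finset Sym} {C : Finset ClkName}

theorem fluentTrace_mono (w : World C) (B : BAT Fl C) (z : Trace) (i : ℕ)
    (h : i + 1 < (fluentTrace w B z).length) :
    ((fluentTrace w B z)[i]).2 ≤ ((fluentTrace w B z)[i + 1]).2 := by
  simpa [fluentTrace] using z.time_take_mono i.le_succ

/-! ### Dependence of configurations on clock values and delays -/

/-- Finality is decided by tests, which are static sentences and see only the trace. -/
theorem Final.of_val {w : World C} {z : Trace} {ν : Val C} {ρ : Prog} (h : Final w z ν ρ)
    (ν' : Val C) : Final w z ν' ρ := by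
  induction h with
  | test α h => exact .test _ _ _ h
  | seq δ₁ δ₂ _ _ h₁ h₂ => exact .seq _ _ _ _ h₁ h₂
  | choice_left δ₁ δ₂ _ h => exact .choice_left _ _ _ _ h
  | choice_right δ₁ δ₂ _ h => exact .choice_right _ _ _ _ h
  | star δ => exact .star _ _ _
  | par δ₁ δ₂ _ _ h₁ h₂ => exact .par _ _ _ _ h₁ h₂

/-- The same action can be taken with another delay and from another clock valuation if its guard
holds there. -/
theorem Step.of_val {w : World C} {B : BAT Fl C} (hw : w.Models B) {z z' : Trace} {ν ν' : Val C}
    {ρ ρ' : Prog} (h : Step w z ν ρ z' ν' ρ') {a : ActName} {t d : ℝ≥0} {μ μ' : Val C}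
    (hz : z' = z.snoc a t) (hg : (B.guardOf a).sat (μ.delay d))
    (h0 : ∀ c : C, w.val (.reset c) (z.snoc a t) → μ' c = 0)
    (h1 : ∀ c : C, ¬ w.val (.reset c) (z.snoc a t) → μ' c = μ c + d) :
    Step w z μ ρ (z.snoc a d) μ' ρ' := by
  induction h with
  | act ν' b e hp =>
    obtain rfl : b = a := by
      have := congrArg Subtype.val hz
      simp only [Trace.snoc, List.append_cancel_left_eq, List.cons.injEq, Prod.mk.injEq] at this
      exact this.1.1
    -- The reset axiom evaluates `γ_c` after `z`, so its truth does not depend on when `b` occurs.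
    have hr (c : C) : w.val (.reset c) (z.snoc b d) ↔ w.val (.reset c) (z.snoc b t) :=
      (hw.reset c z b d).trans (hw.reset c z b t).symm
    exact .act z μ μ' b d hp ((hw.guard _ _ _).2 hg) (fun c hc => h0 c ((hr c).1 hc))
      fun c hc => h1 c fun hc' => hc ((hr c).2 hc')
  | seq_left δ₁ δ₂ z' ν' γ _ ih => exact .seq_left _ _ _ _ _ _ _ (ih hz)
  | seq_right δ₁ δ₂ z' ν' δ' hf _ ih =>
    exact .seq_right _ _ _ _ _ _ _ (hf.of_val μ) (ih hz)
  | choice_left δ₁ δ₂ z' ν' δ' _ ih => exact .choice_left _ _ _ _ _ _ _ (ih hz)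
  | choice_right δ₁ δ₂ z' ν' δ' _ ih => exact .choice_right _ _ _ _ _ _ _ (ih hz)
  | star δ z' ν' γ _ ih => exact .star _ _ _ _ _ _ (ih hz)
  | par_left δ₁ δ₂ z' ν' δ' _ ih => exact .par_left _ _ _ _ _ _ _ (ih hz)
  | par_right δ₁ δ₂ z' ν' δ' _ ih => exact .par_right _ _ _ _ _ _ _ (ih hz)

/-- Keeps just the timing data of the last step, its delay, guard and resets. Its program transition
is dropped, since the lifted path takes its programs from the regionalized product. -/
theorem SymRun.exists_of_append_singleton {w : World C} {B : BAT Fl C} {δ : Prog}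
    {s : List B.Label} {x : B.Label} {z' : Trace} {ν' : Val C} {ρ' : Prog}
    (h : SymRun w B δ (s ++ [x]) z' ν' ρ') :
    ∃ z ν ρ d, SymRun w B δ s z ν ρ ∧ x.guard.sat (ν.delay d) ∧
      (∀ c ∈ x.resets, ν' c = 0) ∧ ∀ c ∉ x.resets, ν' c = ν c + d := by
  generalize hs : s ++ [x] = s' at h
  cases h with
  | nil => simp at hs
  | snoc s₀ z ν _ ρ _ y d hrun _ _ hg h0 h1 =>
    obtain ⟨rfl, hxy⟩ := List.append_inj' hs rfl
    obtain rfl : x = y := by simpa using hxy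
    exact ⟨z, ν, ρ, d, hrun, hg, h0, h1⟩

/-! ### Paths of the two products -/

theorem syncProduct.reachable_mk' {w : World C} {B : BAT Fl C} {hw : w.Models B} {δ : Prog}
    {A : ATA (Set B.Primes)} (K : ℕ) {q : SymState B δ × A.Config}
    (h : (syncProduct w B hw δ A).Reachable q) :
    (regProduct K w B hw δ A).Reachable (RegState.mk' K q) := by
  unfold LTS.Reachable at h
  induction h with
  | refl => exact .refl
  | tail _ hstep ih =>
    obtain ⟨x, hx⟩ := hstep
    exact ih.tail ⟨x, _, _, rfl, hx, rfl⟩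

/-- For every reachable state of the regionalized product and every execution of its symbolic
trace, the synchronous product reaches a state with the same symbolic trace and program and with
the clock values of the execution. -/
theorem regProduct.exists_reachable {w : World C} {B : BAT Fl C} {hw : w.Models B} {δ : Prog}
    {A : ATA (Set B.Primes)} (hA : A.Complete) {K : ℕ} {r : RegState K B δ A}
    (h : (regProduct K w B hw δ A).Reachable r) {z : Trace} {ν : Val C} {ρ : Prog}
    (hz : SymRun w B δ r.trace z ν ρ) :
    ∃ q : SymState B δ × A.Config, (syncProduct w B hw δ A).Reachable q ∧
      q.1.trace = r.trace ∧ q.1.val = ν ∧ q.1.prog = r.prog := by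
  unfold LTS.Reachable at h
  induction h generalizing z ν ρ with
  | refl =>
    change SymRun w B δ [] z ν ρ at hz
    generalize hs : ([] : List B.Label) = s at hz
    cases hz with
    | nil => exact ⟨_, Relation.ReflTransGen.refl, rfl, rfl, rfl⟩
    | snoc => simp at hs
  | tail _ hstep ih =>
    -- The transition supplies the programs and the witness traces `y` and `u`; its delay `t`, clock
    -- values and automaton configurations are going to be replaced.
    obtain ⟨x, p, p', rfl, ⟨t, ⟨htr, hgx, y, hy, hst, hres⟩, F, -, u, hu, -⟩, rfl⟩ := hstep
    change SymRun w B δ p'.1.trace z ν ρ at hz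
    rw [htr] at hz
    obtain ⟨z₀, ν₀, ρ₀, d, hrun, hg, h0, h1⟩ := hz.exists_of_append_singleton
    -- The induction hypothesis is applied to the execution up to its last step, so `e` has the
    -- clock values `ν₀` instead of those of `p`.
    obtain ⟨⟨e, G⟩, hreach, he, hν, hρ⟩ := ih hrun
    obtain ⟨G₁, hG₁⟩ := A.exists_flow d G
    obtain ⟨G₂, hG₂⟩ := hA.exists_edge (fluentSet w B u) G₁
    change e.trace = p.1.trace at he
    change e.val = ν₀ at hν
    change e.prog = p.1.prog at hρ
    refine ⟨(⟨p'.1.trace, ν, p'.1.prog, p'.1.mem_sub⟩, G₂), hreach.tail ⟨x, d, ⟨?_, hgx, y, ?_, ?_,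
      ?_⟩, G₁, hG₁, u, ?_, hG₂⟩, rfl, rfl, rfl⟩
    · exact htr.trans (by rw [he])
    · rwa [he]
    · rw [hν, hρ]
      -- The step after `y` is retimed from `t` to `d`. It need not extend the execution ending in
      -- `z₀`: the product only asks that `y` be induced by the same symbolic trace. The guard holds
      -- at `ν₀ + d` because the label carries `g_a`.
      exact hst.of_val hw rfl (hgx ▸ hg) (fun c hc => h0 c ((hres c).2 hc))
        fun c hc => h1 c fun hc' => hc ((hres c).1 hc')
    · exact fun c => (hres c).trans
        ((hw.reset c y x.act t).trans (hw.reset c y x.act d).symm)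
    · rwa [he]

end

end TESG

theorem mainTheorem7 {Fl : Finset TESG.Sym} {C : Finset TESG.ClkName}
    (B : TESG.BAT Fl C) (δ : TESG.Prog) (w : TESG.World C) (hw : w.Models B)
    (A : TESG.ATA (Set B.Primes)) (hA : A.Complete) (K : ℕ) :
    (∀ z ∈ TESG.regTraces K w B hw δ A, A.HasRun (TESG.fluentTrace w B z)) ∧
    (∀ z, z ∈ TESG.regTraces K w B hw δ A ↔ z ∈ TESG.syncTraces w B hw δ A) := by
  refine ⟨fun z _ => hA.hasRun (TESG.fluentTrace_mono w B z), fun z => ⟨?_, ?_⟩⟩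
  · rintro ⟨_, hr, ⟨p, rfl, y, hy, hfin⟩, ν, ρ, hz⟩
    obtain ⟨q, hq, htr, -, hρ⟩ := TESG.regProduct.exists_reachable hA hr hz
    change q.1.trace = p.1.trace at htr
    change q.1.prog = p.1.prog at hρ
    -- The representative `p` witnessing finality need not be reachable; `q` is, and it shares the
    -- symbolic trace and program of `p`, so `y` also witnesses that `q` is final.
    refine ⟨q, hq, ⟨y, by rwa [htr], ?_⟩, ν, ρ, by rwa [htr]⟩
    rw [hρ]
    exact hfin.of_val _
  · rintro ⟨q, hq, hfin, hz⟩
    exact ⟨TESG.RegState.mk' K q, TESG.syncProduct.reachable_mk' K hq, ⟨q, rfl, hfin⟩, hz⟩
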